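/- **Definitions.** A subset $F$ of a topological space $X$ is *regular closed* if $F=\operatorname{cl}(\operatorname{int}F)$. The set $RC(X)$ of all regular closed subsets of $X$ is a Boolean algebra under $F\vee G=F\cup G$, $F\wedge G=\operatorname{cl}(\operatorname{int}(F\cap G))$, $F^{*}=\operatorname{cl}(X\setminus F)$, $0=\emptyset$, $1=X$, and it carries the contact relation $F\,C_X\,G\iff F\cap G\neq\emptyset$. A *grill* in a Boolean algebra $B$ is a non-empty subset $\Gamma\subseteq B$ such that $0\notin\Gamma$; $a\in\Gamma$ and $a\le b$ imply $b\in\Gamma$; and $a\vee b\in\Gamma$ implies $a\in\Gamma$ or $b\in\Gamma$. A *clan* in $(RC(X),C_X)$ is a grill $\Gamma$ in $RC(X)$ with $F\,C_X\,G$ for all $F,G\in\Gamma$. For $x\in X$ put $\sigma_x=\{F\in RC(X): x\in F\}$. The space $X$ is *semiregular* if every closed subset of $X$ is an intersection of regular closed sets. A semiregular $T_0$-space $X$ is *C-semiregular* (respectively, *extremally connected*) if for every clan $\Gamma$ in $(RC(X),C_X)$ (respectively, every grill $\Gamma$ in $RC(X)$) there is a point $x\in X$ with $\Gamma=\sigma_x$.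 A point $x\in X$ is a *u-point* of $X$ if, for all open $U,V\subseteq X$, $x\in\operatorname{cl}(U)\cap\operatorname{cl}(V)$ implies $x\in\operatorname{cl}(U\cap V)$. A *C-semiregular extension* of $X$ is a pair $(cX,c)$, where $cX$ is a C-semiregular space and $c:X\to cX$ is a homeomorphic embedding with dense image. Open maps are understood to be continuous. **Theorem 9.4.** Let $X$ be an extremally disconnected compact Hausdorff space, $Z$ an extremally connected space, $(cX,c)$ an arbitrary C-semiregular extension of $X$, and $f:X\to Z$ a continuous map such that $f(x)$ is a u-point of $Z$ for every $x\in X$. Then there exists a continuous map $f':cX\to Z$ such that $f=f'\circ c$. In particular, for every open map $f:X\to Z$ there exists a continuous map $f':cX\to Z$ such that $f=f'\circ c$. -/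

import Mathlib

universe u v w

/-- Regular closed subsets of a topological space: the sets `F` with `F = cl (int F)`. -/
@[ext]
structure RegClosed (X : Type u) [TopologicalSpace X] where
  /-- The underlying set. -/
  carrier : Set X
  /-- The set is the closure of its interior. -/
  closure_interior : closure (interior carrier) = carrier

namespace RegClosed

variable {X : Type u} [TopologicalSpace X]

theorem isClosed (F : RegClosed X) : IsClosed F.carrier := by
  rw [← F.closure_interior]
  exact isClosed_closure

/-- The closure of an open set is regular closed. -/
def ofOpen (U : Set X) (hU : IsOpen U) : RegClosed X where
  carrier := closure U
  closure_interior := by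
    apply Set.Subset.antisymm
    · exact closure_minimal interior_subset isClosed_closure
    · exact closure_mono (interior_maximal subset_closure hU)

/-- The order of `RC(X)` is inclusion. -/
instance : PartialOrder (RegClosed X) where
  le F G := F.carrier ⊆ G.carrier
  le_refl F := Set.Subset.refl F.carrier
  le_trans _ _ _ h₁ h₂ := Set.Subset.trans h₁ h₂
  le_antisymm _ _ h₁ h₂ := RegClosed.ext (Set.Subset.antisymm h₁ h₂)

/-- The Boolean algebra `RC(X)`, with `F ⊔ G = F ∪ G`, `F ⊓ G = cl (int (F ∩ G))`,
`Fᶜ = cl (X \ F)`, `⊥ = ∅` and `⊤ = X`. -/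
instance : BooleanAlgebra (RegClosed X) where
  sup F G :=
    { carrier := F.carrier ∪ G.carrier
      closure_interior := by
        apply Set.Subset.antisymm
        · exact closure_minimal interior_subset (F.isClosed.union G.isClosed)
        · apply Set.union_subset
          · calc F.carrier = closure (interior F.carrier) := F.closure_interior.symm
              _ ⊆ _ := closure_mono (interior_mono Set.subset_union_left)
          · calc G.carrier = closure (interior G.carrier) := G.closure_interior.symm
              _ ⊆ _ := closure_mono (interior_mono Set.subset_union_right) }
  le_sup_left F G := Set.subset_union_left (s := F.carrier) (t := G.carrier)
  le_sup_right F G := Set.subset_union_right (s := F.carrier) (t := G.carrier)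
  sup_le _ _ _ h₁ h₂ := Set.union_subset h₁ h₂
  inf F G := ofOpen (interior (F.carrier ∩ G.carrier)) isOpen_interior
  inf_le_left F _ :=
    closure_minimal (interior_subset.trans Set.inter_subset_left) F.isClosed
  inf_le_right _ G :=
    closure_minimal (interior_subset.trans Set.inter_subset_right) G.isClosed
  le_inf F G H h₁ h₂ := by
    change F.carrier ⊆ closure (interior (G.carrier ∩ H.carrier))
    calc F.carrier = closure (interior F.carrier) := F.closure_interior.symm
      _ ⊆ _ := closure_mono (interior_mono (Set.subset_inter h₁ h₂))
  le_sup_inf F G H := by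
    change closure (interior ((F.carrier ∪ G.carrier) ∩ (F.carrier ∪ H.carrier))) ⊆
      F.carrier ∪ closure (interior (G.carrier ∩ H.carrier))
    refine closure_minimal ?_ (F.isClosed.union isClosed_closure)
    intro x hx
    by_cases hF : x ∈ F.carrier
    · exact Or.inl hF
    · refine Or.inr (subset_closure (mem_interior.2
        ⟨interior ((F.carrier ∪ G.carrier) ∩ (F.carrier ∪ H.carrier)) ∩ F.carrierᶜ, ?_,
          isOpen_interior.inter F.isClosed.isOpen_compl, hx, hF⟩))
      rintro y ⟨hy, hyF⟩
      have hy' := interior_subset hy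
      exact ⟨hy'.1.resolve_left hyF, hy'.2.resolve_left hyF⟩
  top := { carrier := Set.univ, closure_interior := by simp }
  bot := { carrier := ∅, closure_interior := by simp }
  le_top F := Set.subset_univ F.carrier
  bot_le F := Set.empty_subset F.carrier
  compl F := ofOpen F.carrierᶜ F.isClosed.isOpen_compl
  inf_compl_le_bot F := by
    change closure (interior (F.carrier ∩ closure F.carrierᶜ)) ⊆ ∅
    have h : interior (F.carrier ∩ closure F.carrierᶜ) = ∅ := by
      rw [interior_inter, closure_compl, interior_compl, F.closure_interior]
      ext x
      simp only [Set.mem_inter_iff, Set.mem_compl_iff, Set.mem_empty_iff_false, iff_false,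
        not_and, not_not]
      exact fun hx => interior_subset hx
    rw [h, closure_empty]
  top_le_sup_compl F := by
    change Set.univ ⊆ F.carrier ∪ closure F.carrierᶜ
    intro x _
    by_cases hF : x ∈ F.carrier
    · exact Or.inl hF
    · exact Or.inr (subset_closure hF)

/-- The standard contact relation on `RC(X)`: two regular closed sets are in contact
when they meet. -/
def Contact (F G : RegClosed X) : Prop := (F.carrier ∩ G.carrier).Nonempty

/-- `σ_x`, the family of all regular closed sets that contain the point `x`. -/
def sigma (x : X) : Set (RegClosed X) := {F | x ∈ F.carrier}

end RegClosed

/-- A grill of a Boolean algebra. -/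
structure IsGrill {B : Type u} [BooleanAlgebra B] (Γ : Set B) : Prop where
  nonempty : Γ.Nonempty
  bot_notMem : ⊥ ∉ Γ
  mem_of_le : ∀ a b : B, a ∈ Γ → a ≤ b → b ∈ Γ
  mem_or_mem : ∀ a b : B, a ⊔ b ∈ Γ → a ∈ Γ ∨ b ∈ Γ

/-- The reflexive and symmetric relation `C^#` on a Boolean algebra that is generated by `C`.
If `C` is a contact relation, then it is `C` itself. -/
def contactSharp {B : Type u} [BooleanAlgebra B] (C : B → B → Prop) (a b : B) : Prop :=
  C a b ∨ C b a ∨ a ⊓ b ≠ ⊥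

/-- A clan of a Boolean algebra with a (pre)contact relation `C`. -/
structure IsClan {B : Type u} [BooleanAlgebra B] (C : B → B → Prop) (Γ : Set B) : Prop
    extends IsGrill Γ where
  contact : ∀ a b : B, a ∈ Γ → b ∈ Γ → contactSharp C a b

/-- A point `x` is a u-point if `x ∈ cl U ∩ cl V` implies `x ∈ cl (U ∩ V)` for all open
`U` and `V`. -/
def IsUPoint {X : Type u} [TopologicalSpace X] (x : X) : Prop :=
  ∀ U V : Set X, IsOpen U → IsOpen V → x ∈ closure U ∩ closure V → x ∈ closure (U ∩ V)

/-- A space is semiregular if the regular closed sets form a closed base, that is, every closed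
set is an intersection of regular closed sets. -/
def IsSemiregular (X : Type u) [TopologicalSpace X] : Prop :=
  ∀ A : Set X, IsClosed A → ∃ R : Set (RegClosed X), A = ⋂ F ∈ R, F.carrier

/-- C-semiregular spaces: semiregular T₀-spaces in which every clan of the contact algebra
`RC(X)` is of the form `σ_x`. -/
structure IsCSemiregular (X : Type u) [TopologicalSpace X] : Prop where
  t0 : T0Space X
  semiregular : IsSemiregular X
  exists_point : ∀ Γ : Set (RegClosed X), IsClan RegClosed.Contact Γ →
    ∃ x : X, Γ = RegClosed.sigma x

/-- Extremally connected spaces: semiregular T₀-spaces in which every grill of the Boolean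
algebra `RC(X)` is of the form `σ_x`. -/
structure IsExtremallyConnected (X : Type u) [TopologicalSpace X] : Prop where
  t0 : T0Space X
  semiregular : IsSemiregular X
  exists_point : ∀ Γ : Set (RegClosed X), IsGrill Γ → ∃ x : X, Γ = RegClosed.sigma x

/-- `(cX, c)` is a C-semiregular extension of `X`: the space `cX` is C-semiregular and `c` is a
dense embedding of `X` into `cX`. -/
structure IsCSemiregularExtension {X : Type u} {cX : Type v} [TopologicalSpace X]
    [TopologicalSpace cX] (c : X → cX) : Prop where
  isCSemiregular : IsCSemiregular cX
  isDenseEmbedding : IsDenseEmbedding c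

/-!
A point `y` of `cX` determines the set `K y` of all cluster points in `X` of the trace
`comap c (𝓝 y)` of its neighbourhood filter; by density of `c` and compactness of `X` it is
nonempty. The union of the grills `σ_{f x}`, `x ∈ K y`, is again a grill in `RC(Z)`, so
extremal connectedness of `Z` gives a point `f' y` with
`f' y ∈ G ↔ ∃ x ∈ K y, f x ∈ G` for all regular closed `G`.

* `f' ∘ c = f`: as `c` is inducing and `X` is Hausdorff, `K (c x) = {x}`, and in a semiregular
  T₀-space a point is determined by the regular closed sets containing it.
* `f'` is continuous: a u-point never lies on the boundary of a regular closed set `G`, so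
  `f ⁻¹' G` is clopen. For a clopen set `A`, `K y` meets `A` exactly when `y ∈ cl (c '' A)`
  (`inter_nonempty_traceCluster_iff`). Hence `f' ⁻¹' G = cl (c '' (f ⁻¹' G))` is closed, and the
  regular closed sets form a closed base of `Z`.

If `f` is open, then `f ⁻¹'` commutes with closure; the closures of disjoint open sets of an
extremally disconnected space are disjoint, more generally `cl A ∩ cl B = cl (A ∩ B)` for open
`A`, `B`. So every value of an open map is a u-point, and the second part follows from the first.

The first part uses of `X` only that it is compact Hausdorff, and of `(cX, c)` only that `c` is a
dense embedding.
-/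

open Filter Topology

/-! ### Regular closed sets, grills and u-points -/

theorem RegClosed.isGrill_sigma {X : Type u} [TopologicalSpace X] (x : X) :
    IsGrill (RegClosed.sigma x) where
  nonempty := ⟨⊤, Set.mem_univ x⟩
  bot_notMem h := h
  mem_of_le _ _ ha hab := hab ha
  mem_or_mem _ _ h := h

theorem IsGrill.biUnion {B : Type u} [BooleanAlgebra B] {ι : Type v} {K : Set ι}
    (hK : K.Nonempty) {Γ : ι → Set B} (hΓ : ∀ i ∈ K, IsGrill (Γ i)) :
    IsGrill (⋃ i ∈ K, Γ i) where
  nonempty := by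
    obtain ⟨i, hi⟩ := hK
    exact (hΓ i hi).nonempty.mono (Set.subset_biUnion_of_mem hi)
  bot_notMem h := by
    obtain ⟨i, hi, h⟩ := Set.mem_iUnion₂.1 h
    exact (hΓ i hi).bot_notMem h
  mem_of_le a b ha hab := by
    obtain ⟨i, hi, h⟩ := Set.mem_iUnion₂.1 ha
    exact Set.mem_iUnion₂.2 ⟨i, hi, (hΓ i hi).mem_of_le a b h hab⟩
  mem_or_mem a b h := by
    obtain ⟨i, hi, h⟩ := Set.mem_iUnion₂.1 h
    exact ((hΓ i hi).mem_or_mem a b h).imp (fun h => Set.mem_iUnion₂.2 ⟨i, hi, h⟩)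
      (fun h => Set.mem_iUnion₂.2 ⟨i, hi, h⟩)

theorem IsSemiregular.mem_of_sigma_subset {Z : Type v} [TopologicalSpace Z]
    (hZ : IsSemiregular Z) {z w : Z} (h : RegClosed.sigma z ⊆ RegClosed.sigma w)
    {A : Set Z} (hA : IsClosed A) (hz : z ∈ A) : w ∈ A := by
  obtain ⟨R, rfl⟩ := hZ A hA
  exact Set.mem_iInter₂.2 fun F hF => h (Set.mem_iInter₂.1 hz F hF)

theorem IsSemiregular.sigma_injective {Z : Type v} [TopologicalSpace Z] [T0Space Z]
    (hZ : IsSemiregular Z) : Function.Injective (RegClosed.sigma : Z → Set (RegClosed Z)) := by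
  intro z w h
  refine (inseparable_iff_forall_isClosed.2 fun A hA => ⟨?_, ?_⟩).eq
  · exact hZ.mem_of_sigma_subset h.subset hA
  · exact hZ.mem_of_sigma_subset h.symm.subset hA

theorem IsSemiregular.continuous_of_isClosed_preimage {Y : Type u} {Z : Type v}
    [TopologicalSpace Y] [TopologicalSpace Z] (hZ : IsSemiregular Z) {g : Y → Z}
    (hg : ∀ G : RegClosed Z, IsClosed (g ⁻¹' G.carrier)) : Continuous g := by
  refine continuous_iff_isClosed.2 fun A hA => ?_
  obtain ⟨R, rfl⟩ := hZ A hA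
  rw [Set.preimage_iInter₂]
  exact isClosed_biInter fun G _ => hg G

/-- A u-point does not lie on the boundary of a regular closed set `G`: otherwise it would lie in
the closures of the disjoint open sets `int G` and `Gᶜ`. -/
theorem IsUPoint.mem_interior {Z : Type v} [TopologicalSpace Z] {z : Z} (hz : IsUPoint z)
    {G : RegClosed Z} (h : z ∈ G.carrier) : z ∈ interior G.carrier := by
  by_contra hi
  rw [← Set.mem_compl_iff, ← closure_compl] at hi
  rw [← G.closure_interior] at h
  have := hz _ _ isOpen_interior G.isClosed.isOpen_compl ⟨h, hi⟩
  rwa [(Set.disjoint_compl_right_iff_subset.2 interior_subset).inter_eq, closure_empty] at this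

theorem IsUPoint.isClopen_preimage {X : Type u} {Z : Type v} [TopologicalSpace X]
    [TopologicalSpace Z] {f : X → Z} (hf : Continuous f) (hu : ∀ x, IsUPoint (f x))
    (G : RegClosed Z) : IsClopen (f ⁻¹' G.carrier) := by
  refine ⟨G.isClosed.preimage hf, ?_⟩
  have : f ⁻¹' G.carrier = f ⁻¹' interior G.carrier :=
    Set.Subset.antisymm (fun x hx => (hu x).mem_interior hx)
      (Set.preimage_mono interior_subset)
  rw [this]
  exact isOpen_interior.preimage hf

theorem ExtremallyDisconnected.closure_inter_closure_subset {X : Type u} [TopologicalSpace X]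
    [ExtremallyDisconnected X] {A B : Set X} (hA : IsOpen A) (hB : IsOpen B) :
    closure A ∩ closure B ⊆ closure (A ∩ B) :=
  (ExtremallyDisconnected.open_closure A hA).inter_closure.trans
    (closure_minimal hB.closure_inter isClosed_closure)

theorem IsOpenMap.isUPoint {X : Type u} {Z : Type v} [TopologicalSpace X]
    [TopologicalSpace Z] [ExtremallyDisconnected X] {f : X → Z} (ho : IsOpenMap f)
    (hf : Continuous f) (x : X) : IsUPoint (f x) := by
  rintro U V hU hV ⟨hxU, hxV⟩
  have h := ExtremallyDisconnected.closure_inter_closure_subset (hU.preimage hf)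
    (hV.preimage hf)
    ⟨ho.preimage_closure_subset_closure_preimage hxU,
      ho.preimage_closure_subset_closure_preimage hxV⟩
  rw [← Set.preimage_inter] at h
  exact hf.closure_preimage_subset _ h

/-! ### Cluster points of the trace of a neighbourhood filter -/

/-- The set `K y` of the points of `X` at which the trace `comap c (𝓝 y)` of the neighbourhood
filter of `y` clusters; equivalently, the points `x` such that `y ∈ cl (c '' U)` for every
neighbourhood `U` of `x`. -/
def traceCluster {X : Type u} {Y : Type v} [TopologicalSpace X] [TopologicalSpace Y]
    (c : X → Y) (y : Y) : Set X :=
  {x | ClusterPt x (comap c (𝓝 y))}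

theorem mem_closure_image_iff_comap_inf_neBot {X : Type u} {Y : Type v} [TopologicalSpace Y]
    {c : X → Y} {y : Y} {A : Set X} :
    y ∈ closure (c '' A) ↔ (comap c (𝓝 y) ⊓ 𝓟 A).NeBot := by
  rw [mem_closure_iff_clusterPt, ClusterPt, ← map_principal, inf_comm, ← neBot_inf_comap_iff_map,
    inf_comm]

/-- For clopen `A`, the closed set `cl (c '' A)` consists of the points whose trace clusters in `A`.
Openness of `A` gives one implication, compactness of `A` the other. -/
theorem inter_nonempty_traceCluster_iff {X : Type u} {Y : Type v} [TopologicalSpace X]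
    [TopologicalSpace Y] [CompactSpace X] {c : X → Y} {y : Y} {A : Set X} (hA : IsClopen A) :
    (traceCluster c y ∩ A).Nonempty ↔ y ∈ closure (c '' A) := by
  rw [mem_closure_image_iff_comap_inf_neBot]
  constructor
  · rintro ⟨x, hx, hxA⟩
    refine (show (𝓝 x ⊓ comap c (𝓝 y)).NeBot from hx).mono ?_
    rw [inf_comm]
    exact inf_le_inf_left _ (le_principal_iff.2 (hA.isOpen.mem_nhds hxA))
  · intro h
    obtain ⟨x, hxA, hx⟩ := hA.isClosed.isCompact (f := comap c (𝓝 y) ⊓ 𝓟 A) inf_le_right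
    exact ⟨x, hx.mono inf_le_left, hxA⟩

theorem traceCluster_nonempty {X : Type u} {Y : Type v} [TopologicalSpace X]
    [TopologicalSpace Y] [CompactSpace X] {c : X → Y} (hc : DenseRange c) (y : Y) :
    (traceCluster c y).Nonempty := by
  rw [← Set.inter_univ (traceCluster c y), inter_nonempty_traceCluster_iff isClopen_univ,
    Set.image_univ]
  exact hc y

theorem Topology.IsInducing.traceCluster_apply {X : Type u} {Y : Type v} [TopologicalSpace X]
    [TopologicalSpace Y] [T2Space X] {c : X → Y} (hc : IsInducing c) (x : X) :
    traceCluster c (c x) = {x} := by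
  ext x'
  rw [traceCluster, Set.mem_ofPred_eq, ← hc.nhds_eq_comap, Set.mem_singleton_iff]
  refine ⟨fun h => eq_of_nhds_neBot h, ?_⟩
  rintro rfl
  rw [ClusterPt, inf_idem]
  infer_instance

/-! ### The extension -/

theorem IsExtremallyConnected.exists_continuous_extension {X : Type u} {Z : Type v} {Y : Type w}
    [TopologicalSpace X] [TopologicalSpace Z] [TopologicalSpace Y] [CompactSpace X] [T2Space X]
    (hZ : IsExtremallyConnected Z) {c : X → Y} (hc : IsDenseEmbedding c) {f : X → Z}
    (hf : Continuous f) (hu : ∀ x, IsUPoint (f x)) :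
    ∃ f' : Y → Z, Continuous f' ∧ f = f' ∘ c := by
  have := hZ.t0
  choose f' hf' using fun y => hZ.exists_point _
    (IsGrill.biUnion (traceCluster_nonempty hc.dense y)
      fun x _ => RegClosed.isGrill_sigma (f x))
  refine ⟨f', hZ.semiregular.continuous_of_isClosed_preimage fun G => ?_, funext fun x => ?_⟩
  · have : f' ⁻¹' G.carrier = closure (c '' (f ⁻¹' G.carrier)) := by
      ext y
      rw [← inter_nonempty_traceCluster_iff (IsUPoint.isClopen_preimage hf hu G)]
      change G ∈ RegClosed.sigma (f' y) ↔ _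
      rw [← hf' y, Set.mem_iUnion₂]
      exact ⟨fun ⟨x, hx, h⟩ => ⟨x, hx, h⟩, fun ⟨x, hx, h⟩ => ⟨x, hx, h⟩⟩
    rw [this]
    exact isClosed_closure
  · apply hZ.semiregular.sigma_injective
    rw [Function.comp_apply, ← hf' (c x), hc.isInducing.traceCluster_apply,
      Set.biUnion_singleton]

theorem theorem9p4 {X : Type u} {Z : Type v} {cX : Type w}
    [TopologicalSpace X] [TopologicalSpace Z] [TopologicalSpace cX]
    [ExtremallyDisconnected X] [CompactSpace X] [T2Space X]
    (hZ : IsExtremallyConnected Z)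
    (c : X → cX) (hc : IsCSemiregularExtension c) :
    (∀ f : X → Z, Continuous f → (∀ x : X, IsUPoint (f x)) →
      ∃ f' : cX → Z, Continuous f' ∧ f = f' ∘ c) ∧
    (∀ f : X → Z, Continuous f → IsOpenMap f →
      ∃ f' : cX → Z, Continuous f' ∧ f = f' ∘ c) :=
  ⟨fun _ hf hu => hZ.exists_continuous_extension hc.isDenseEmbedding hf hu,
    fun _ hf ho => hZ.exists_continuous_extension hc.isDenseEmbedding hf (ho.isUPoint hf)⟩
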